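/- For nonzero integers $m,n$ let $B(m,n)=\langle a,b : a^{-1}b^{m}a=b^{n}\rangle$ be the Baumslag--Solitar group, and let $|\cdot|_a : B(m,n)\to\mathbb{Z}$ be the homomorphism with $|a|_a=1$ and $|b|_a=0$ (the exponent sum of $a$). For an endomorphism $\phi$ of a group $G$, two elements $x,y\in G$ are $\phi$-conjugate if $y=g\,x\,\phi(g)^{-1}$ for some $g\in G$; the Reidemeister number $R(\phi)$ is the number of $\phi$-conjugacy classes. Theorem. Let $m,n$ be integers with $|m|>1$, $|n|>1$ and $|m|\neq|n|$ (in particular, any $m,n$ with $1<m<|n|$). Then every injective endomorphism $\phi$ of $B(m,n)$ induces the identity on the quotient $B(m,n)/\ker|\cdot|_a\cong\mathbb{Z}$, that is, $|\phi(g)|_a=|g|_a$ for all $g\in B(m,n)$, and $R(\phi)=\infty$. -/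

import Mathlib

/-- The two generators of a Baumslag-Solitar group. -/
inductive BSGen : Type
  | a : BSGen
  | b : BSGen

/-- The relator `a⁻¹ bᵐ a (bⁿ)⁻¹` in the free group on `a, b`. -/
def bsRelator (m n : ℤ) : FreeGroup BSGen :=
  (FreeGroup.of BSGen.a)⁻¹ * FreeGroup.of BSGen.b ^ m * FreeGroup.of BSGen.a *
    (FreeGroup.of BSGen.b ^ n)⁻¹

/-- The Baumslag-Solitar group `B(m,n) = ⟨a, b : a⁻¹ bᵐ a = bⁿ⟩`. -/
abbrev BaumslagSolitar (m n : ℤ) : Type :=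
  PresentedGroup ({bsRelator m n} : Set (FreeGroup BSGen))

/-- The values on the generators of the exponent sum in `a`: `a ↦ 1`, `b ↦ 0`. -/
def bsGenExp : BSGen → Multiplicative ℤ
  | BSGen.a => Multiplicative.ofAdd 1
  | BSGen.b => 1

theorem bsGenExp_relator (m n : ℤ) :
    ∀ r ∈ ({bsRelator m n} : Set (FreeGroup BSGen)), FreeGroup.lift bsGenExp r = 1 := by
  intro r hr
  rw [Set.mem_singleton_iff.mp hr]
  simp [bsRelator, bsGenExp]

/-- The homomorphism `B(m,n) → ℤ` sending a word to the sum of the exponents of `a` in it. -/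
def bsExpSum (m n : ℤ) : BaumslagSolitar m n →* Multiplicative ℤ :=
  PresentedGroup.toGroup (bsGenExp_relator m n)

/-- Twisted conjugacy: `x` and `y` are `φ`-conjugate if `y = g x φ(g)⁻¹` for some `g`. -/
def twistedConjSetoid {G : Type*} [Group G] (φ : G →* G) : Setoid G where
  r x y := ∃ g : G, y = g * x * (φ g)⁻¹
  iseqv :=
    { refl := fun x => ⟨1, by simp⟩
      symm := by
        rintro x y ⟨g, rfl⟩
        exact ⟨g⁻¹, by simp [mul_assoc]⟩
      trans := by
        rintro x y z ⟨g, rfl⟩ ⟨h, rfl⟩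
        exact ⟨h * g, by simp [mul_assoc]⟩ }

/-- The Reidemeister number of `φ`: the number of `φ`-conjugacy classes (`⊤` if infinite). -/
noncomputable def reidemeisterNumber {G : Type*} [Group G] (φ : G →* G) : ℕ∞ :=
  ENat.card (Quotient (twistedConjSetoid φ))

/-! `B(m,n)` is an HNN extension of `⟨b⟩ ≅ ℤ`. Powers of a nonempty cyclically reduced word grow
linearly in length, while conjugation by a fixed element adds only a bounded amount. Hence an
element with conjugate `m`-th and `n`-th powers, `|m| ≠ |n|`, is conjugate into `⟨b⟩`
(`exists_isConj_genB_zpow`). This applies to `φ(b)`, which is thus conjugate to some `b ^ k`;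
injectivity gives `k ≠ 0`. The same conjugation turns `φ(a)` into an element taking `b ^ (k * m)` to
`b ^ (k * n)`. The ratio of such exponents is `(n / m) ^ |g|_a` (`div_eq_zpow_bsExpSum`), and `|n /
m| ≠ 1` forces `|φ(a)|_a = 1`. Once `φ` preserves `|·|_a`, this sum is constant on twisted classes
and separates the powers of `a`. -/

namespace HNNExtension

/-! ### Reduced words and conjugate powers in HNN extensions -/

variable {G : Type*} [Group G] {A B : Subgroup G} (φ : A ≃* B)

/-- The product of the syllables `t ^ u * g` of a word in an HNN extension. -/
def syllableProd (l : List (ℤˣ × G)) : HNNExtension G A B φ :=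
  (l.map (fun x => t ^ (x.1 : ℤ) * of x.2)).prod

@[simp]
theorem syllableProd_nil : syllableProd φ [] = 1 := rfl

@[simp]
theorem syllableProd_cons (x : ℤˣ × G) (l : List (ℤˣ × G)) :
    syllableProd φ (x :: l) = t ^ (x.1 : ℤ) * of x.2 * syllableProd φ l := by
  simp [syllableProd]

@[simp]
theorem syllableProd_append (l l' : List (ℤˣ × G)) :
    syllableProd φ (l ++ l') = syllableProd φ l * syllableProd φ l' := by
  simp [syllableProd]

theorem syllableProd_flatten_replicate (l : List (ℤˣ × G)) (k : ℕ) :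
    syllableProd φ (List.replicate k l).flatten = syllableProd φ l ^ k := by
  induction k with
  | zero => simp
  | succ k ih => simp [List.replicate_succ, ih, pow_succ']

variable (A B) in
/-- The relation between consecutive syllables saying that they admit no cancellation. -/
def NoCancel (x y : ℤˣ × G) : Prop := x.2 ∈ toSubgroup A B x.1 → x.1 = y.1

/-- `t ^ u * g * t ^ (-u)` lies in the base group if `g ∈ toSubgroup A B u`. -/
theorem exists_of_eq_conj {u : ℤˣ} {g : G} (hg : g ∈ toSubgroup A B u) :
    ∃ y : G, (t ^ (u : ℤ) * of g * t ^ ((-u : ℤˣ) : ℤ) : HNNExtension G A B φ) = of y := by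
  rcases Int.units_eq_one_or u with rfl | rfl
  · exact ⟨φ ⟨g, hg⟩, by simp [equiv_eq_conj]⟩
  · exact ⟨φ.symm ⟨g, hg⟩, by simp [equiv_symm_eq_conj]⟩

theorem eq_neg_of_ne {u v : ℤˣ} (h : u ≠ v) : v = -u := by
  rcases Int.units_eq_one_or u with rfl | rfl <;> rcases Int.units_eq_one_or v with rfl | rfl <;>
    simp_all

/-- Every word can be reduced without increasing the number of syllables. -/
theorem exists_reduced (h : G) (l : List (ℤˣ × G)) :
    ∃ (h' : G) (l' : List (ℤˣ × G)), l'.IsChain (NoCancel A B) ∧ l'.length ≤ l.length ∧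
      of h' * syllableProd φ l' = of h * syllableProd φ l := by
  induction l generalizing h with
  | nil => exact ⟨h, [], by simp⟩
  | cons x l ih =>
    obtain ⟨h', l', hc, hlen, hp⟩ := ih x.2
    have hx : of h * syllableProd φ (x :: l) =
        of h * t ^ (x.1 : ℤ) * of h' * syllableProd φ l' := by
      simp only [syllableProd_cons, mul_assoc] at hp ⊢
      rw [hp]
    rw [hx]
    rcases l' with _ | ⟨y, l''⟩
    · exact ⟨h, [(x.1, h')], by simp, by simp, by simp [mul_assoc]⟩
    by_cases hxy : NoCancel A B (x.1, h') y
    · exact ⟨h, (x.1, h') :: y :: l'', List.isChain_cons_cons.2 ⟨hxy, hc⟩, by simpa using hlen,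
        by simp [mul_assoc]⟩
    · simp only [NoCancel, not_forall] at hxy
      obtain ⟨hmem, hne⟩ := hxy
      obtain ⟨z, hz⟩ := exists_of_eq_conj φ hmem
      refine ⟨h * z * y.2, l'', hc.tail, by simp at hlen ⊢; omega, ?_⟩
      rw [map_mul, map_mul, ← hz, syllableProd_cons, eq_neg_of_ne hne]
      simp only [mul_assoc]

/-- Every element is the product of some word. -/
theorem exists_word (g : HNNExtension G A B φ) :
    ∃ (h : G) (l : List (ℤˣ × G)), of h * syllableProd φ l = g := by
  obtain ⟨d⟩ := NormalWord.TransversalPair.nonempty G A B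
  obtain ⟨w, hw⟩ := (NormalWord.equiv (φ := φ) (d := d)).symm.surjective g
  exact ⟨w.head, w.toList, hw⟩

/-- A reduced word has the least number of syllables among all words for the same element. -/
theorem length_le_of_isChain {h h' : G} {l l' : List (ℤˣ × G)} (hl : l.IsChain (NoCancel A B))
    (heq : of h * syllableProd φ l = of h' * syllableProd φ l') : l.length ≤ l'.length := by
  obtain ⟨k, r, hr, hlen, hp⟩ := exists_reduced φ h' l'
  have := (ReducedWord.map_fst_eq_and_of_prod_eq φ
    (w₁ := ⟨h, l, hl⟩) (w₂ := ⟨k, r, hr⟩) (heq.trans hp.symm)).1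
  have := congrArg List.length this
  simp only [List.length_map] at this
  omega

/-- Every element is conjugate into the base group, or to the product of a nonempty cyclically
reduced word. -/
theorem isConj_of_or_cyclicallyReduced (l : List (ℤˣ × G)) (h : G)
    (hl : l.IsChain (NoCancel A B)) :
    (∃ x : G, IsConj (of h * syllableProd φ l) (of x)) ∨
      ∃ l' : List (ℤˣ × G), l' ≠ [] ∧ (l' ++ l').IsChain (NoCancel A B) ∧
        IsConj (of h * syllableProd φ l) (syllableProd φ l') := by
  induction hN : l.length using Nat.strong_induction_on generalizing l h with
  | _ N ih =>
  subst hN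
  rcases l.eq_nil_or_concat' with rfl | ⟨l, ⟨u, g⟩, rfl⟩
  · exact Or.inl ⟨h, by rw [syllableProd_nil, mul_one]⟩
  have hconj : IsConj (of h * syllableProd φ (l ++ [(u, g)]))
      (syllableProd φ (l ++ [(u, g * h)])) :=
    isConj_iff.2 ⟨(of h)⁻¹, by simp [mul_assoc]⟩
  have hl' : (l ++ [(u, g * h)]).IsChain (NoCancel A B) := by
    rw [List.isChain_append] at hl ⊢
    refine ⟨hl.1, by simp, fun x hx y hy => ?_⟩
    have := hl.2.2 x hx (u, g) (by simp)
    simp only [List.head?_cons, Option.mem_def, Option.some.injEq] at hy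
    subst hy
    exact this
  by_cases hcyc : ((l ++ [(u, g * h)]) ++ (l ++ [(u, g * h)])).IsChain (NoCancel A B)
  · exact Or.inr ⟨_, by simp, hcyc, hconj⟩
  rcases l with _ | ⟨⟨v, k⟩, l⟩
  -- A single syllable is always cyclically reduced: its sign agrees with itself.
  · simp [NoCancel] at hcyc
  have hnc : ¬ NoCancel A B (u, g * h) (v, k) := by
    intro hnc
    refine hcyc (List.isChain_append.2 ⟨hl', hl', fun x hx y hy => ?_⟩)
    simp only [List.getLast?_append, List.getLast?_singleton, Option.some_or,
      Option.mem_def, Option.some.injEq] at hx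
    simp only [List.cons_append, List.head?_cons, Option.mem_def, Option.some.injEq] at hy
    subst hx hy
    exact hnc
  simp only [NoCancel, not_forall] at hnc
  obtain ⟨hmem, hne⟩ := hnc
  obtain rfl := eq_neg_of_ne hne
  obtain ⟨z, hz⟩ := exists_of_eq_conj φ hmem
  -- Moving the last syllable to the front cancels it against the first, leaving two syllables
  -- fewer.
  have hconj' : IsConj (of h * syllableProd φ ((-u, k) :: l ++ [(u, g)]))
      (of (z * k) * syllableProd φ l) := by
    refine hconj.trans (isConj_iff.2 ⟨t ^ (u : ℤ) * of (g * h), ?_⟩)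
    rw [map_mul of z k, ← hz]
    simp [mul_assoc]
  have hsub : l.IsChain (NoCancel A B) :=
    (List.isChain_append.1 hl).1.tail
  rcases ih l.length (by simp) l (z * k) hsub rfl with ⟨x, hx⟩ | ⟨l', h1, h2, h3⟩
  · exact Or.inl ⟨x, hconj'.trans hx⟩
  · exact Or.inr ⟨l', h1, h2, hconj'.trans h3⟩

/-- Powers of a cyclically reduced word are reduced. -/
theorem isChain_flatten_replicate {α : Type*} {R : α → α → Prop} {l : List α}
    (hl : (l ++ l).IsChain R) (k : ℕ) : (List.replicate k l).flatten.IsChain R := by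
  rw [List.isChain_append] at hl
  have hhead : ∀ k, ∀ y ∈ (List.replicate k l).flatten.head?, y ∈ l.head? := by
    intro k y hy
    cases k with
    | zero => simp at hy
    | succ k =>
      cases l with
      | nil => simp at hy
      | cons a l => simpa [List.replicate_succ] using hy
  induction k with
  | zero => simp
  | succ k ih =>
    rw [List.replicate_succ, List.flatten_cons, List.isChain_append]
    exact ⟨hl.1, ih, fun x hx y hy => hl.2.2 x hx y (hhead k y hy)⟩

/-- `C` does not depend on `l`, so it becomes negligible for high powers. -/
theorem exists_word_conj (c g : HNNExtension G A B φ) :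
    ∃ C : ℕ, ∀ l : List (ℤˣ × G), ∃ (h : G) (l' : List (ℤˣ × G)),
      l'.length ≤ l.length + C ∧ of h * syllableProd φ l' = c * syllableProd φ l * g := by
  obtain ⟨h₁, l₁, rfl⟩ := exists_word φ c
  obtain ⟨h₂, l₂, rfl⟩ := exists_word φ g
  -- The base element `h₂` needs a syllable to sit in, so it is inserted as `t * 1 * t⁻¹ * h₂`; this
  -- costs the `+ 2`.
  refine ⟨l₁.length + l₂.length + 2, fun l => ⟨h₁, l₁ ++ l ++
    (1, 1) :: (-1, h₂) :: l₂, ?_, ?_⟩⟩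
  · simp; omega
  · simp [mul_assoc]

/-- If powers `w ^ M`, `w ^ N` of a cyclically reduced word are conjugate, then `N ≤ M`. -/
theorem le_of_conj_pow_eq {l : List (ℤˣ × G)} (hne : l ≠ [])
    (hl : (l ++ l).IsChain (NoCancel A B)) (c : HNNExtension G A B φ) {M N : ℕ}
    (h : c * syllableProd φ l ^ M * c⁻¹ = syllableProd φ l ^ N) : N ≤ M := by
  by_contra! hlt
  obtain ⟨C, hC⟩ := exists_word_conj φ c c⁻¹
  -- With the exponents scaled by `C + 1`, the two lengths differ by at least `C + 1`, more than
  -- conjugation can add.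
  obtain ⟨x, l', hlen, hp⟩ := hC (List.replicate (M * (C + 1)) l).flatten
  rw [syllableProd_flatten_replicate, pow_mul, ← conj_pow, h, ← pow_mul,
    ← syllableProd_flatten_replicate] at hp
  have := length_le_of_isChain φ (isChain_flatten_replicate hl (N * (C + 1))) (h := 1)
    (h' := x) (l' := l') (by simp [hp])
  have h1 : 1 ≤ l.length := List.length_pos_iff.2 hne
  simp only [List.length_flatten, List.map_replicate, List.sum_replicate, smul_eq_mul] at this hlen
  have h2 : (M + 1) * (C + 1) * l.length ≤ N * (C + 1) * l.length := by gcongr; omega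
  nlinarith

/-- An element with two conjugate powers `g ^ M`, `g ^ N`, where `M ≠ N`, is conjugate into the
base group. -/
theorem exists_isConj_of_of_conj_pow_eq (g c : HNNExtension G A B φ) {M N : ℕ} (hMN : M ≠ N)
    (h : c * g ^ M * c⁻¹ = g ^ N) : ∃ x : G, IsConj g (of x) := by
  obtain ⟨y, l, hyl⟩ := exists_word φ g
  obtain ⟨y', l', hl', -, hp⟩ := exists_reduced φ y l
  rw [hyl] at hp
  subst hp
  refine (isConj_of_or_cyclicallyReduced φ l' y' hl').resolve_right ?_
  rintro ⟨r, hne, hr, hconj⟩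
  obtain ⟨d, hd⟩ := isConj_iff.1 hconj
  have key : (d * c * d⁻¹) * syllableProd φ r ^ M * (d * c * d⁻¹)⁻¹ = syllableProd φ r ^ N := by
    rw [← hd, conj_pow, conj_pow, ← h]
    group
  have key' : (d * c * d⁻¹)⁻¹ * syllableProd φ r ^ N * (d * c * d⁻¹)⁻¹⁻¹ =
      syllableProd φ r ^ M := by
    rw [← key]
    group
  exact hMN (le_antisymm (le_of_conj_pow_eq φ hne hr _ key') (le_of_conj_pow_eq φ hne hr _ key))

end HNNExtension

theorem conj_zpow_mul {G : Type*} [Group G] {c x : G} {p q : ℤ} (h : c⁻¹ * x ^ p * c = x ^ q)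
    (k : ℤ) : c⁻¹ * x ^ (p * k) * c = x ^ (q * k) := by
  rw [zpow_mul, zpow_mul, ← h]
  simpa using (conj_zpow (a := c⁻¹) (b := x ^ p)).symm

/-! ### `B(m,n)` as an HNN extension, and the ratio of conjugate powers of `b` -/

namespace BaumslagSolitar

variable {m n : ℤ}

/-- The stable letter `a` of `B(m,n)`. -/
def genA (m n : ℤ) : BaumslagSolitar m n := PresentedGroup.of BSGen.a

/-- The base letter `b` of `B(m,n)`. -/
def genB (m n : ℤ) : BaumslagSolitar m n := PresentedGroup.of BSGen.b

theorem conj_genB_zpow (m n : ℤ) : (genA m n)⁻¹ * genB m n ^ m * genA m n = genB m n ^ n := by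
  have h := PresentedGroup.one_of_mem (Set.mem_singleton (bsRelator m n))
  exact mul_inv_eq_one.1 h

@[simp]
theorem bsExpSum_genA : bsExpSum m n (genA m n) = Multiplicative.ofAdd 1 :=
  PresentedGroup.toGroup.of _

@[simp]
theorem bsExpSum_genB : bsExpSum m n (genB m n) = 1 :=
  PresentedGroup.toGroup.of _

theorem mem_of_genA_genB_mem {S : Subgroup (BaumslagSolitar m n)} (ha : genA m n ∈ S)
    (hb : genB m n ∈ S) (g : BaumslagSolitar m n) : g ∈ S := by
  have h : (⊤ : Subgroup (BaumslagSolitar m n)) ≤ S := by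
    rw [← PresentedGroup.closure_range_of, Subgroup.closure_le]
    rintro _ ⟨x, rfl⟩
    cases x
    · exact ha
    · exact hb
  exact h trivial

theorem zpowGroupHom_int_injective (hm : m ≠ 0) :
    Function.Injective (zpowGroupHom m : Multiplicative ℤ →* Multiplicative ℤ) :=
  zpow_left_injective hm

/-- The isomorphism `mℤ ≃ nℤ`, `m * k ↦ n * k`, written multiplicatively. -/
noncomputable def multiplesEquiv (hm : m ≠ 0) (hn : n ≠ 0) :
    (zpowGroupHom m : Multiplicative ℤ →* Multiplicative ℤ).range ≃*
      (zpowGroupHom n : Multiplicative ℤ →* Multiplicative ℤ).range :=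
  (MonoidHom.ofInjective (zpowGroupHom_int_injective hm)).symm.trans
    (MonoidHom.ofInjective (zpowGroupHom_int_injective hn))

theorem multiplesEquiv_apply (hm : m ≠ 0) (hn : n ≠ 0) (x : Multiplicative ℤ) :
    multiplesEquiv hm hn ⟨x ^ m, x, rfl⟩ = ⟨x ^ n, x, rfl⟩ := by
  have : (⟨x ^ m, x, rfl⟩ : (zpowGroupHom m : Multiplicative ℤ →* Multiplicative ℤ).range) =
      MonoidHom.ofInjective (zpowGroupHom_int_injective hm) x := rfl
  rw [this, multiplesEquiv, MulEquiv.trans_apply, MulEquiv.symm_apply_apply]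
  rfl

/-- `B(m,n)` as an HNN extension of `ℤ`. -/
abbrev HNN (hm : m ≠ 0) (hn : n ≠ 0) : Type :=
  HNNExtension (Multiplicative ℤ) _ _ (multiplesEquiv hm hn)

/-- The images of the generators of `B(m,n)` in the HNN extension. -/
noncomputable def genToHNN (hm : m ≠ 0) (hn : n ≠ 0) : BSGen → HNN hm hn
  -- The inverse appears because `t * x * t⁻¹` realises the isomorphism, whereas the relator uses
  -- `a⁻¹ * x * a`.
  | BSGen.a => HNNExtension.t⁻¹
  | BSGen.b => HNNExtension.of (Multiplicative.ofAdd 1)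

theorem genToHNN_relator (hm : m ≠ 0) (hn : n ≠ 0) :
    ∀ r ∈ ({bsRelator m n} : Set (FreeGroup BSGen)), FreeGroup.lift (genToHNN hm hn) r = 1 := by
  intro r hr
  rw [Set.mem_singleton_iff.mp hr]
  have h := HNNExtension.equiv_eq_conj (φ := multiplesEquiv hm hn)
    ⟨Multiplicative.ofAdd 1 ^ m, _, rfl⟩
  rw [multiplesEquiv_apply] at h
  simp only [map_zpow] at h
  simp only [bsRelator, map_mul, map_inv, map_zpow, FreeGroup.lift_apply_of, genToHNN, h, inv_inv]
  exact mul_inv_cancel _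

/-- The canonical map from `B(m,n)` to the HNN extension. -/
noncomputable def toHNN (hm : m ≠ 0) (hn : n ≠ 0) : BaumslagSolitar m n →* HNN hm hn :=
  PresentedGroup.toGroup (genToHNN_relator hm hn)

/-- The canonical map from the HNN extension to `B(m,n)`. -/
noncomputable def ofHNN (hm : m ≠ 0) (hn : n ≠ 0) : HNN hm hn →* BaumslagSolitar m n :=
  HNNExtension.lift (zpowersHom _ (genB m n)) (genA m n)⁻¹ (by
    rintro ⟨_, x, rfl⟩
    have h : multiplesEquiv hm hn ⟨zpowGroupHom m x, x, rfl⟩ = ⟨x ^ n, x, rfl⟩ :=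
      multiplesEquiv_apply hm hn x
    rw [h]
    simp only [zpowGroupHom_apply, map_zpow]
    rw [eq_mul_inv_iff_mul_eq, zpowersHom_apply, ← zpow_mul, ← zpow_mul, mul_comm _ m,
      mul_comm _ n]
    exact conj_zpow_mul (conj_genB_zpow m n) _)

/-- Conjugacies found in the HNN extension are brought back to `B(m,n)` by this identity. -/
theorem ofHNN_toHNN (hm : m ≠ 0) (hn : n ≠ 0) (g : BaumslagSolitar m n) :
    ofHNN hm hn (toHNN hm hn g) = g := by
  have h : (ofHNN hm hn).comp (toHNN hm hn) = MonoidHom.id _ := by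
    ext x
    cases x <;> simp [ofHNN, toHNN, genToHNN, genA, genB]
  exact DFunLike.congr_fun h g

theorem genB_zpow_injective (hm : m ≠ 0) (hn : n ≠ 0) :
    Function.Injective (fun k : ℤ => genB m n ^ k) := by
  intro j k hjk
  have h := congrArg (toHNN hm hn) hjk
  simp only [map_zpow, toHNN, genB, PresentedGroup.toGroup.of, genToHNN] at h
  rw [← map_zpow HNNExtension.of, ← map_zpow HNNExtension.of] at h
  simpa [← ofAdd_zsmul] using HNNExtension.of_injective _ h

/-- If `c⁻¹ x ^ m c = x ^ n` with `|m| ≠ |n|`, then `x` is conjugate to a power of `b`. -/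
theorem exists_isConj_genB_zpow (hm : m ≠ 0) (hn : n ≠ 0) (hmn : |m| ≠ |n|)
    {x c : BaumslagSolitar m n} (h : c⁻¹ * x ^ m * c = x ^ n) :
    ∃ k : ℤ, IsConj x (genB m n ^ k) := by
  -- Applying the relation twice gives the exponents `m ^ 2` and `n ^ 2`, which removes the signs.
  have hsq : (c⁻¹ * c⁻¹) * x ^ (m.natAbs ^ 2) * (c⁻¹ * c⁻¹)⁻¹ = x ^ (n.natAbs ^ 2) := by
    rw [← zpow_natCast, ← zpow_natCast]
    push_cast
    rw [sq_abs, sq_abs, sq, sq, ← conj_zpow_mul h n, mul_comm m n,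
      ← conj_zpow_mul h m]
    simp only [mul_inv_rev, inv_inv, mul_assoc]
  have hne : m.natAbs ^ 2 ≠ n.natAbs ^ 2 := by
    intro he
    apply hmn
    rw [Int.abs_eq_natAbs, Int.abs_eq_natAbs, Nat.pow_left_injective two_ne_zero he]
  obtain ⟨y, hy⟩ := HNNExtension.exists_isConj_of_of_conj_pow_eq (multiplesEquiv hm hn)
    (toHNN hm hn x) (toHNN hm hn (c⁻¹ * c⁻¹)) hne (by
      rw [← map_pow, ← map_pow, ← map_inv, ← map_mul, ← map_mul, hsq])
  refine ⟨y.toAdd, ?_⟩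
  have := (ofHNN hm hn).map_isConj hy
  rwa [ofHNN_toHNN, ofHNN, HNNExtension.lift_of, zpowersHom_apply] at this

/-- The elements conjugating a nontrivial power of `b` to the power prescribed by their exponent
sum in `a`. -/
def commensurator (hm : m ≠ 0) (hn : n ≠ 0) : Subgroup (BaumslagSolitar m n) where
  carrier := {g | ∃ p q : ℤ, p ≠ 0 ∧ q ≠ 0 ∧ g⁻¹ * genB m n ^ p * g = genB m n ^ q ∧
    (q : ℚ) / p = (n / m : ℚ) ^ (bsExpSum m n g).toAdd}
  one_mem' := ⟨1, 1, by simp⟩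
  mul_mem' := by
    rintro g h ⟨p, q, hp, hq, hg, hpq⟩ ⟨r, s, hr, hs, hh, hrs⟩
    have hr0 : (n / m : ℚ) ≠ 0 := by positivity
    refine ⟨p * r, q * s, mul_ne_zero hp hr, mul_ne_zero hq hs, ?_, ?_⟩
    · rw [mul_comm q s, ← conj_zpow_mul hh q, mul_comm r q, ← conj_zpow_mul hg r]
      group
    · rw [map_mul, toAdd_mul, zpow_add₀ hr0, ← hpq, ← hrs]
      push_cast
      rw [mul_div_mul_comm]
  inv_mem' := by
    rintro g ⟨p, q, hp, hq, hg, hpq⟩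
    refine ⟨q, p, hq, hp, ?_, ?_⟩
    · rw [← hg]
      group
    · rw [map_inv, toAdd_inv, zpow_neg, ← hpq, inv_div]

/-- It suffices to check the generators: `a` contributes the ratio `n / m`, and `b` the ratio `1`.
-/
theorem mem_commensurator (hm : m ≠ 0) (hn : n ≠ 0) (g : BaumslagSolitar m n) :
    g ∈ commensurator hm hn := by
  refine mem_of_genA_genB_mem ?_ ?_ g
  · exact ⟨m, n, hm, hn, conj_genB_zpow m n, by simp⟩
  · exact ⟨1, 1, one_ne_zero, one_ne_zero, by simp, by simp⟩

/-- An element conjugating `b ^ p` to `b ^ q`, where `p, q ≠ 0`, satisfies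
`q / p = (n / m) ^ |g|_a`. -/
theorem div_eq_zpow_bsExpSum (hm : m ≠ 0) (hn : n ≠ 0) {g : BaumslagSolitar m n} {p q : ℤ}
    (hp : p ≠ 0) (h : g⁻¹ * genB m n ^ p * g = genB m n ^ q) :
    (q : ℚ) / p = (n / m : ℚ) ^ (bsExpSum m n g).toAdd := by
  obtain ⟨r, s, hr, hs, hg, hrs⟩ := mem_commensurator hm hn g
  rw [← hrs]
  -- Conjugating `b ^ (p * r)` by `g` in two ways compares the two ratios, as `b` has infinite
  -- order.
  have h2 := conj_zpow_mul hg p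
  rw [mul_comm r p, conj_zpow_mul h r] at h2
  have h3 : q * r = s * p := genB_zpow_injective hm hn h2
  rw [div_eq_div_iff (by exact_mod_cast hp) (by exact_mod_cast hr)]
  exact_mod_cast h3

/-! ### Endomorphisms and the exponent sum -/

theorem bsExpSum_eq_of_isConj {x y : BaumslagSolitar m n} (h : IsConj x y) :
    bsExpSum m n x = bsExpSum m n y :=
  isConj_iff_eq.1 ((bsExpSum m n).map_isConj h)

theorem bsExpSum_map_of_injective (hm : m ≠ 0) (hn : n ≠ 0) (hmn : |m| ≠ |n|)
    (φ : BaumslagSolitar m n →* BaumslagSolitar m n) (hφ : Function.Injective φ)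
    (g : BaumslagSolitar m n) : bsExpSum m n (φ g) = bsExpSum m n g := by
  have hrel : (φ (genA m n))⁻¹ * φ (genB m n) ^ m * φ (genA m n) = φ (genB m n) ^ n := by
    simp only [← map_zpow, ← map_inv, ← map_mul, conj_genB_zpow]
  obtain ⟨k, hk⟩ := exists_isConj_genB_zpow hm hn hmn hrel
  have hb : bsExpSum m n (φ (genB m n)) = bsExpSum m n (genB m n) := by
    rw [bsExpSum_eq_of_isConj hk, map_zpow, bsExpSum_genB, one_zpow]
  have hk0 : k ≠ 0 := by
    rintro rfl
    rw [zpow_zero, isConj_comm, isConj_one_right, map_eq_one_iff φ hφ] at hk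
    have := genB_zpow_injective hm hn (a₁ := 1) (a₂ := 0) (by simpa using hk)
    exact one_ne_zero this
  obtain ⟨d, hd⟩ := isConj_iff.1 hk
  have hconj : (d * φ (genA m n) * d⁻¹)⁻¹ * genB m n ^ (k * m) * (d * φ (genA m n) * d⁻¹) =
      genB m n ^ (k * n) := by
    rw [zpow_mul, zpow_mul, ← hd, conj_zpow, conj_zpow, ← hrel]
    group
  have hdiv := div_eq_zpow_bsExpSum hm hn (mul_ne_zero hk0 hm) hconj
  have hm' : (m : ℚ) ≠ 0 := by exact_mod_cast hm
  have hn' : (n : ℚ) ≠ 0 := by exact_mod_cast hn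
  have hk' : (k : ℚ) ≠ 0 := by exact_mod_cast hk0
  have ha : bsExpSum m n (φ (genA m n)) = bsExpSum m n (genA m n) := by
    rw [bsExpSum_eq_of_isConj (isConj_iff.2 ⟨d, rfl⟩ : IsConj (φ (genA m n)) _), bsExpSum_genA]
    push_cast at hdiv
    rw [mul_div_mul_left _ _ hk'] at hdiv
    -- Absolute values make the base positive and different from `1`, so the exponent is determined.
    have habs := congrArg abs hdiv
    rw [abs_zpow, eq_comm] at habs
    have hpos : 0 < |(n / m : ℚ)| := by positivity
    have hne : |(n / m : ℚ)| ≠ 1 := by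
      rw [abs_div, Ne, div_eq_one_iff_eq (by positivity)]
      exact_mod_cast hmn.symm
    have := zpow_right_injective₀ hpos hne (habs.trans (zpow_one _).symm)
    exact Multiplicative.toAdd.injective this
  exact mem_of_genA_genB_mem (S := ((bsExpSum m n).comp φ).eqLocus (bsExpSum m n)) ha hb g

/-- An endomorphism preserving the exponent sum in `a` has infinite Reidemeister number. -/
theorem reidemeisterNumber_eq_top (φ : BaumslagSolitar m n →* BaumslagSolitar m n)
    (h : ∀ g, bsExpSum m n (φ g) = bsExpSum m n g) : reidemeisterNumber φ = ⊤ := by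
  rw [reidemeisterNumber, ENat.card_eq_top]
  refine Infinite.of_injective
    (fun k : ℤ => Quotient.mk (twistedConjSetoid φ) (genA m n ^ k)) fun j k hjk => ?_
  obtain ⟨g, hg⟩ := Quotient.exact hjk
  have := congrArg (bsExpSum m n) hg
  rw [map_mul, map_mul, map_inv, h, mul_inv_cancel_comm, map_zpow, map_zpow, bsExpSum_genA] at this
  simpa [← ofAdd_zsmul] using this.symm

end BaumslagSolitar

theorem theorem4p4 (m n : ℤ) (hm : 1 < |m|) (hn : 1 < |n|) (hmn : |m| ≠ |n|)
    (φ : BaumslagSolitar m n →* BaumslagSolitar m n) (hφ : Function.Injective φ) :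
    (∀ g : BaumslagSolitar m n, bsExpSum m n (φ g) = bsExpSum m n g) ∧
      reidemeisterNumber φ = ⊤ := by
  have hm0 : m ≠ 0 := abs_pos.1 (zero_lt_one.trans hm)
  have hn0 : n ≠ 0 := abs_pos.1 (zero_lt_one.trans hn)
  have h := BaumslagSolitar.bsExpSum_map_of_injective hm0 hn0 hmn φ hφ
  exact ⟨h, BaumslagSolitar.reidemeisterNumber_eq_top φ h⟩
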